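/- **Theorem.** Let $r\ge 2$ be an integer and $\alpha\ge 1$ a rational number. Structures are $r$-uniform hypergraphs (one $r$-ary relation, symmetric and holding only on tuples of distinct elements; $r=2$: graphs), substructures are induced. For a finite structure $A$ put $\delta(A)=\alpha\,|A|-e(A)$, where $e(A)$ is the number of edges; for finite $A\subseteq B$ write $A\leqslant B$ if $\delta(C)\ge\delta(A)$ for all $A\subseteq C\subseteq B$; for an infinite structure $N$ and a finite $A\subseteq N$ write $A\leqslant N$ if $A\leqslant B$ for every finite $B$ with $A\subseteq B\subseteq N$. Let $\mathcal K_\alpha^+$ be the class of finite structures all of whose substructures have $\delta\ge 0$. For disjoint finite $A,B$ inside a structure in $\mathcal K_\alpha^+$, with $B\ne\emptyset$, say that $B$ is *$0$-algebraic over $A$* if $\delta(A\cup B)=\delta(A)$ and $\delta(A\cup B_0)>\delta(A)$ for all $\emptyset\ne B_0\subsetneq B$, and *$0$-minimally algebraic over $A$* if moreover it is not $0$-algebraic over any proper subset of $A$. Let $\mathcal E$ be either the set of all isomorphism types of pairs $(A,B)$ with $A\cup B\in\mathcal K_\alpha^+$, $B$ $0$-minimally algebraic over $A$ and $A\ne\emptyset$,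 or the set of all such types with $A=\emptyset$ also allowed. Let $\mu:\mathcal E\to\mathbb N$ be finite-to-one with $\mu(A,B)\ge\delta(A)$ for all $(A,B)\in\mathcal E$; in the case $r=2$, $\alpha=1$ assume in addition $\mu(A,B)\ge 3$ whenever $(A,B)\in\mathcal E$ and $A\neq\emptyset$. Let $\mathcal K_\alpha^\mu$ be the class of all $D\in\mathcal K_\alpha^+$ such that for every $(A,B)\in\mathcal E$ and every copy $A'\subseteq D$ of $A$, the number of pairwise disjoint isomorphic copies of $B$ over $A'$ in $D$ is at most $\mu(A,B)$. Let $\mathbf M_\alpha^\mu$ be the $(\mathcal K_\alpha^\mu,\leqslant)$-generic structure, i.e. a countable structure $\mathbf M$ such that: (1) the finite substructures of $\mathbf M$ are, up to isomorphism, exactly the members of $\mathcal K_\alpha^\mu$; (2) $\mathbf M=\bigcup_i A_i$ for finite $A_0\leqslant A_1\leqslant\cdots$; (3) whenever $A\leqslant\mathbf M$ is finite and $A\leqslant B\in\mathcal K_\alpha^\mu$, there is an embedding $\Gamma:B\to\mathbf M$ that is the identity on $A$ and satisfies $\Gamma[B]\leqslant\mathbf M$. Then $\mathrm{Aut}(\mathbf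 M_\alpha^\mu)$, with the topology of pointwise convergence, is not amenable: there is a continuous action of it on a nonempty compact Hausdorff space without invariant Borel probability measure. In particular (the case $r=3$, $\alpha=1$) the automorphism group of Hrushovski's strongly minimal set is not amenable. -/

import Mathlib

namespace Collapsed

/-! ### Uniform hypergraphs -/

/-- An `r`-uniform hypergraph on the vertex type `V`: a structure in the language with one `r`-ary
relation that is symmetric and holds only on tuples of distinct elements. The case `r = 2` is that of
(simple) graphs. -/
@[ext]
structure UHypergraph (r : ℕ) (V : Type*) where
  edges : Set (Finset V)
  uniform : ∀ e ∈ edges, e.card = r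

section Structures

variable {r : ℕ} {V W : Type*}

/-- `f` is an embedding of structures (onto an induced substructure). -/
def IsEmb (H : UHypergraph r V) (K : UHypergraph r W) (f : V ↪ W) : Prop :=
  ∀ e : Finset V, e.map f ∈ K.edges ↔ e ∈ H.edges

/-- The induced substructure on a finite set of vertices. -/
def UHypergraph.induce (H : UHypergraph r V) (S : Finset V) : UHypergraph r S where
  edges := {e | e.map (Function.Embedding.subtype _) ∈ H.edges}
  uniform := fun e he => by simpa using H.uniform _ he

open Classical in
/-- The predimension `α * |S| - (number of edges inside S)`. -/
noncomputable def predim (α : ℚ) (H : UHypergraph r V) (S : Finset V) : ℚ :=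
  α * S.card - (S.powerset.filter (fun e => e ∈ H.edges)).card

/-- `A ≤ B` inside `H`: `A ⊆ B` and `δ(C) - δ(A) ≥ 0` whenever `A ⊆ C ⊆ B`. -/
def ClosedIn (α : ℚ) (H : UHypergraph r V) (A B : Finset V) : Prop :=
  A ⊆ B ∧ ∀ C : Finset V, A ⊆ C → C ⊆ B → 0 ≤ predim α H C - predim α H A

/-- `A ≤ H`: the finite set `A` is closed in every finite substructure of `H` containing it. -/
def Closed (α : ℚ) (H : UHypergraph r V) (A : Finset V) : Prop :=
  ∀ B : Finset V, A ⊆ B → ClosedIn α H A B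

/-- Every finite substructure has nonnegative predimension. For finite `V` this says that `H` is in
the ab-initio class of `α`. -/
def InAbInitio (α : ℚ) (H : UHypergraph r V) : Prop :=
  ∀ S : Finset V, 0 ≤ predim α H S

variable [DecidableEq V]

/-- The nonempty set `B`, disjoint from `A`, is `0`-algebraic over `A`. -/
def ZeroAlg (α : ℚ) (H : UHypergraph r V) (B A : Finset V) : Prop :=
  Disjoint A B ∧ B.Nonempty ∧ predim α H (A ∪ B) - predim α H A = 0 ∧
    ∀ B₀ : Finset V, B₀.Nonempty → B₀ ⊂ B → 0 < predim α H (A ∪ B₀) - predim α H A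

/-- `B` is `0`-minimally algebraic over `A`. -/
def ZeroMinAlg (α : ℚ) (H : UHypergraph r V) (B A : Finset V) : Prop :=
  ZeroAlg α H B A ∧ ∀ A₀ : Finset V, A₀ ⊂ A → ¬ ZeroAlg α H B A₀

end Structures

/-! ### Pairs and the function `μ` -/

/-- A concrete pair `(A, B)` of disjoint finite sets together with a structure on `A ∪ B`; the
elements of `A ∪ B` are numbered `0, …, n - 1`, and `B` is the complement of `A`. Every finite pair
is isomorphic to one of these, and to only finitely many of them. -/
structure Pair (r : ℕ) where
  n : ℕ
  H : UHypergraph r (Fin n)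
  A : Finset (Fin n)

/-- The second component of the pair. -/
def Pair.B {r : ℕ} (P : Pair r) : Finset (Fin P.n) := P.Aᶜ

/-- Isomorphism of pairs: an isomorphism of the structures that takes `A` to `A` (and so `B` to
`B`). -/
def Pair.Iso {r : ℕ} (P Q : Pair r) : Prop :=
  ∃ e : Fin P.n ≃ Fin Q.n, IsEmb P.H Q.H e.toEmbedding ∧ P.A.map e.toEmbedding = Q.A

/-- All pairs `(A, B)` with `A ∪ B` in the ab-initio class and `B` `0`-minimally algebraic over
`A`, where `A` may be empty. -/
def minAlgPairs (r : ℕ) (α : ℚ) : Set (Pair r) :=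
  {P | InAbInitio α P.H ∧ ZeroMinAlg α P.H P.B P.A}

/-- The pairs of `minAlgPairs` with nonempty base `A`. -/
def minAlgPairsNonempty (r : ℕ) (α : ℚ) : Set (Pair r) :=
  {P | P ∈ minAlgPairs r α ∧ P.A.Nonempty}

/-- `μ` is an admissible bounding function on the set `E` of pairs: it depends only on the
isomorphism type, it is finite-to-one on isomorphism types, and `μ(A, B) ≥ δ(A)`. Its values outside
`E` play no role. -/
structure IsMu {r : ℕ} (α : ℚ) (E : Set (Pair r)) (μ : Pair r → ℕ) : Prop where
  iso_invariant : ∀ P ∈ E, ∀ Q ∈ E, P.Iso Q → μ P = μ Q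
  finite_to_one : ∀ k : ℕ, {P | P ∈ E ∧ μ P = k}.Finite
  lower_bound : ∀ P ∈ E, predim α P.H P.A ≤ (μ P : ℚ)

/-- Membership of `H` in the collapsed class of `μ`: `H` is in the ab-initio class, and for every
pair `(A, B)` in `E` and every copy of `A` in `H`, the number of pairwise disjoint copies of `B` over
that copy of `A` is at most `μ(A, B)`. A family of such copies is given by embeddings of `A ∪ B` that
agree on `A` and have pairwise disjoint images of `B`. -/
def InCollapsed {r : ℕ} {V : Type*} (α : ℚ) (E : Set (Pair r)) (μ : Pair r → ℕ)
    (H : UHypergraph r V) : Prop :=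
  InAbInitio α H ∧
    ∀ P ∈ E, ∀ F : Finset (Fin P.n ↪ V),
      (∀ f ∈ F, IsEmb P.H H f) →
      (∀ f ∈ F, ∀ g ∈ F, ∀ a ∈ P.A, f a = g a) →
      (∀ f ∈ F, ∀ g ∈ F, f ≠ g → Disjoint (P.B.map f) (P.B.map g)) →
      F.card ≤ μ P

/-! ### Generic structures -/

/-- `M` is the generic structure of the class `K` of finite structures with the closedness relation
given by `α`. Only the values of `K` on finite types are used. -/
structure IsGeneric {r : ℕ} {V : Type} (α : ℚ) (K : ∀ W : Type, UHypergraph r W → Prop)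
    (M : UHypergraph r V) : Prop where
  countable : Countable V
  age_subset : ∀ S : Finset V, K S (M.induce S)
  subset_age : ∀ (W : Type) [Finite W] (H : UHypergraph r W), K W H → ∃ f : W ↪ V, IsEmb H M f
  chain : ∃ A : ℕ → Finset V, (∀ i, ClosedIn α M (A i) (A (i + 1))) ∧ ∀ v, ∃ i, v ∈ A i
  extension : ∀ A : Finset V, Closed α M A →
    ∀ (W : Type) [Fintype W] (H : UHypergraph r W), K W H →
    ∀ i : A ↪ W, IsEmb (M.induce A) H i → Closed α H (Finset.univ.map i) →
    ∃ f : W ↪ V, IsEmb H M f ∧ (∀ a : A, f (i a) = a) ∧ Closed α M (Finset.univ.map f)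

/-! ### Automorphism groups and amenability -/

/-- The topology of pointwise convergence on the group of permutations of a discrete set. -/
instance permTopology (V : Type*) : TopologicalSpace (Equiv.Perm V) :=
  TopologicalSpace.induced (fun (g : Equiv.Perm V) (v : V) => g v)
    (@Pi.topologicalSpace V (fun _ => V) (fun _ => ⊥))

/-- The automorphism group of a structure, with the topology induced from the permutation group. -/
def aut {r : ℕ} {V : Type*} (M : UHypergraph r V) : Subgroup (Equiv.Perm V) where
  carrier := {g | IsEmb M M g.toEmbedding}
  one_mem' := by
    intro e
    have : e.map (1 : Equiv.Perm V).toEmbedding = e := Finset.map_refl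
    rw [this]
  mul_mem' := by
    intro g h hg hh e
    have : e.map (g * h).toEmbedding = (e.map h.toEmbedding).map g.toEmbedding := by
      rw [Finset.map_map]; rfl
    rw [this, hg, hh]
  inv_mem' := by
    intro g hg e
    have : (e.map (g⁻¹).toEmbedding).map g.toEmbedding = e := by
      rw [Finset.map_map]
      ext x; simp
    rw [← hg (e.map (g⁻¹).toEmbedding), this]

/-- Every continuous action on a nonempty compact Hausdorff space has an invariant Borel probability
measure. -/
def IsAmenable (G : Type) [Group G] [TopologicalSpace G] : Prop :=
  ∀ (X : Type) [TopologicalSpace X] [CompactSpace X] [T2Space X] [Nonempty X]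
    [MeasurableSpace X] [BorelSpace X] [MulAction G X] [ContinuousSMul G X],
    ∃ m : MeasureTheory.Measure X, MeasureTheory.IsProbabilityMeasure m ∧
      ∀ g : G, m.map (fun x => g • x) = m

end Collapsed

/-! The obstruction to amenability is a fractional orientation: each edge distributes weight $1$
among its points, and no point receives more than $\alpha$. Since every finite set has $\delta\ge
0$, Hall's theorem yields such orientations (`exists_isOrientation`). They form a compact space on
which the automorphism group acts continuously. All defining conditions are linear, so averaging
over an invariant measure produces an invariant orientation
(`IsAmenable.exists_invariant_orientation`).

By homogeneity, the stabiliser of a closed edge permutes its points transitively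
(`IsGeneric.exists_aut_of_closed_edges`), so an invariant orientation must give each of them weight
$1/r$. A closed star of $n$ edges through one point, each edge being itself closed, then puts weight
$n/r$ on the centre, so $n\le\alpha r$ (`natCast_le_of_closed_star`).

On the other hand, stars lie in the collapsed class (`inCollapsed_star`): minimality forces the base
of two disjoint copies to be the centre alone, and a single point has no $0$-algebraic extension in
a star unless $\alpha(r-1)=1$. Hence $n$ is arbitrary, except that $n=3$ is used for $r=2$,
$\alpha=1$; there $3>2=\alpha r$ still gives a contradiction. -/

namespace Collapsed

/-! ### Submodularity of the predimension and transitivity of closedness -/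

section Predimension

variable {r : ℕ} {V W : Type*}

theorem predim_map (α : ℚ) {H : UHypergraph r V} {K : UHypergraph r W} {f : V ↪ W}
    (hf : IsEmb H K f) (S : Finset V) : predim α K (S.map f) = predim α H S := by
  classical
  unfold predim
  have h : ((S.map f).powerset.filter fun e => e ∈ K.edges) =
      (S.powerset.filter fun e => e ∈ H.edges).map (Finset.mapEmbedding f).toEmbedding := by
    ext e
    simp only [Finset.mem_filter, Finset.mem_powerset, Finset.mem_map,
      RelEmbedding.coe_toEmbedding, Finset.mapEmbedding_apply]
    constructor
    · rintro ⟨he, heK⟩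
      obtain ⟨d, hd, rfl⟩ := Finset.subset_map_iff.1 he
      exact ⟨d, ⟨hd, (hf d).1 heK⟩, rfl⟩
    · rintro ⟨d, ⟨hd, hdH⟩, rfl⟩
      exact ⟨Finset.map_subset_map.2 hd, (hf d).2 hdH⟩
  rw [h, Finset.card_map, Finset.card_map]

theorem isEmb_subtype (M : UHypergraph r V) (S : Finset V) :
    IsEmb (M.induce S) M (Function.Embedding.subtype (· ∈ S)) :=
  fun _ => Iff.rfl

theorem predim_submodular [DecidableEq V] {α : ℚ} (H : UHypergraph r V) (A B : Finset V) :
    predim α H (A ∪ B) + predim α H (A ∩ B) ≤ predim α H A + predim α H B := by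
  classical
  unfold predim
  have h1 := Finset.card_union_add_card_inter A B
  have h2 := Finset.card_union_add_card_inter
    (A.powerset.filter fun e => e ∈ H.edges) (B.powerset.filter fun e => e ∈ H.edges)
  have h3 : ((A.powerset.filter fun e => e ∈ H.edges) ∪
      (B.powerset.filter fun e => e ∈ H.edges)).card ≤
      ((A ∪ B).powerset.filter fun e => e ∈ H.edges).card := by
    refine Finset.card_le_card fun e => ?_
    simp only [Finset.mem_union, Finset.mem_filter, Finset.mem_powerset]
    rintro (⟨h, h'⟩ | ⟨h, h'⟩)
    · exact ⟨h.trans Finset.subset_union_left, h'⟩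
    · exact ⟨h.trans Finset.subset_union_right, h'⟩
  have h4 : ((A.powerset.filter fun e => e ∈ H.edges) ∩
      (B.powerset.filter fun e => e ∈ H.edges)) =
      ((A ∩ B).powerset.filter fun e => e ∈ H.edges) := by
    ext e
    simp only [Finset.mem_inter, Finset.mem_filter, Finset.mem_powerset, Finset.subset_inter_iff]
    tauto
  rw [h4] at h2
  have h5 : ((A.powerset.filter fun e => e ∈ H.edges).card : ℚ) +
      (B.powerset.filter fun e => e ∈ H.edges).card ≤
      ((A ∪ B).powerset.filter fun e => e ∈ H.edges).card +
      ((A ∩ B).powerset.filter fun e => e ∈ H.edges).card := by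
    exact_mod_cast (by omega)
  have h6 : ((A ∪ B).card : ℚ) + (A ∩ B).card = A.card + B.card := by exact_mod_cast h1
  linear_combination h5 + α * h6

/-- Submodularity gives $\delta(C)-\delta(C\cap B)\ge\delta(C\cup B)-\delta(B)\ge 0$, and
$\delta(C\cap B)\ge\delta(A)$ because $A\leqslant B$. -/
theorem ClosedIn.trans_closed {α : ℚ} {H : UHypergraph r V} {A B : Finset V}
    (hAB : ClosedIn α H A B) (hB : Closed α H B) : Closed α H A := by
  classical
  refine fun D hD => ⟨hD, fun C hAC _ => ?_⟩
  have h1 := predim_submodular (α := α) H C B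
  have h2 := (hB (C ∪ B) Finset.subset_union_right).2 (C ∪ B) Finset.subset_union_right le_rfl
  have h3 := hAB.2 (C ∩ B) (Finset.subset_inter hAC hAB.1) Finset.inter_subset_right
  linarith

theorem ClosedIn.trans {α : ℚ} {H : UHypergraph r V} {A B D : Finset V}
    (hAB : ClosedIn α H A B) (hBD : ClosedIn α H B D) : ClosedIn α H A D := by
  classical
  refine ⟨hAB.1.trans hBD.1, fun C hAC hCD => ?_⟩
  have h1 := predim_submodular (α := α) H C B
  have h2 := hBD.2 (C ∪ B) Finset.subset_union_right (Finset.union_subset hCD hBD.1)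
  have h3 := hAB.2 (C ∩ B) (Finset.subset_inter hAC hAB.1) Finset.inter_subset_right
  linarith

theorem Closed.map {α : ℚ} {H : UHypergraph r V} {K : UHypergraph r W} {f : V ↪ W}
    (hf : IsEmb H K f) {A B : Finset V} (hA : Closed α H A) (hAB : A ⊆ B) :
    ClosedIn α K (A.map f) (B.map f) := by
  refine ⟨Finset.map_subset_map.2 hAB, fun C hAC hCB => ?_⟩
  obtain ⟨D, hD, rfl⟩ := Finset.subset_map_iff.1 hCB
  rw [predim_map α hf, predim_map α hf]
  exact (hA B hAB).2 D (Finset.map_subset_map.1 hAC) hD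

theorem Closed.of_map {α : ℚ} {H : UHypergraph r V} {K : UHypergraph r W} {f : V ↪ W}
    (hf : IsEmb H K f) {A : Finset V} (hA : Closed α K (A.map f)) : Closed α H A := by
  refine fun B hAB => ⟨hAB, fun C hAC _ => ?_⟩
  have h := (hA (C.map f) (Finset.map_subset_map.2 hAC)).2 (C.map f)
    (Finset.map_subset_map.2 hAC) le_rfl
  rwa [predim_map α hf, predim_map α hf] at h

end Predimension

/-! ### Homogeneity of the generic structure -/

section Homogeneity

variable {r : ℕ} {V : Type} {α : ℚ} {K : ∀ W : Type, UHypergraph r W → Prop}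
  {M : UHypergraph r V}

theorem IsGeneric.exists_closed_superset (hM : IsGeneric α K M) (S : Finset V) :
    ∃ B, S ⊆ B ∧ Closed α M B := by
  classical
  obtain ⟨A, hA, hcov⟩ := hM.chain
  have hmono : Monotone A := monotone_nat_of_le_succ fun i => (hA i).1
  have hfin : ∀ S : Finset V, ∃ i, S ⊆ A i := by
    intro S
    induction S using Finset.induction_on with
    | empty => exact ⟨0, by simp⟩
    | insert v S _ ih =>
      obtain ⟨i, hi⟩ := ih
      obtain ⟨j, hj⟩ := hcov v
      exact ⟨max i j, Finset.insert_subset (hmono (le_max_right i j) hj)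
        (hi.trans (hmono (le_max_left i j)))⟩
  have hle : ∀ i k, ClosedIn α M (A i) (A (i + k)) := by
    intro i k
    induction k with
    | zero =>
      refine ⟨le_rfl, fun C h1 h2 => ?_⟩
      rw [Finset.Subset.antisymm h2 h1]
      simp
    | succ k ih => exact ih.trans (hA (i + k))
  obtain ⟨i, hi⟩ := hfin S
  refine ⟨A i, hi, fun B hB => ⟨hB, fun C hC hCB => ?_⟩⟩
  obtain ⟨j, hj⟩ := hfin C
  exact (hle i j).2 C hC (hj.trans (hmono (Nat.le_add_left j i)))

/-- A finite partial isomorphism between closed subsets, given by its graph. -/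
structure IsPartialIso [DecidableEq V] (α : ℚ) (M : UHypergraph r V) (R : Finset (V × V)) :
    Prop where
  eq_iff : ∀ p ∈ R, ∀ q ∈ R, p.1 = q.1 ↔ p.2 = q.2
  edges_iff : ∀ T ⊆ R, T.image Prod.fst ∈ M.edges ↔ T.image Prod.snd ∈ M.edges
  closed_fst : Closed α M (R.image Prod.fst)
  closed_snd : Closed α M (R.image Prod.snd)

theorem IsPartialIso.swap [DecidableEq V] {R : Finset (V × V)} (hR : IsPartialIso α M R) :
    IsPartialIso α M (R.image Prod.swap) := by
  have h1 : ∀ T : Finset (V × V), (T.image Prod.swap).image Prod.fst = T.image Prod.snd := by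
    intro T; rw [Finset.image_image]; rfl
  have h2 : ∀ T : Finset (V × V), (T.image Prod.swap).image Prod.snd = T.image Prod.fst := by
    intro T; rw [Finset.image_image]; rfl
  refine ⟨?_, ?_, ?_, ?_⟩
  · intro p hp q hq
    obtain ⟨p, hp', rfl⟩ := Finset.mem_image.1 hp
    obtain ⟨q, hq', rfl⟩ := Finset.mem_image.1 hq
    exact (hR.eq_iff p hp' q hq').symm
  · intro T hT
    obtain ⟨T, hT', rfl⟩ := Finset.subset_image_iff.1 hT
    rw [h1, h2]
    exact (hR.edges_iff T (by exact_mod_cast hT')).symm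
  · rw [h1]; exact hR.closed_snd
  · rw [h2]; exact hR.closed_fst

/-- The "forth" step; "back" follows by swapping coordinates. The range of `R` is mapped by the
inverse of `R` into a closed set `A` containing `v` and the domain, and the extension property over
the range realises `A` as a closed set. -/
theorem IsGeneric.extend_partialIso [DecidableEq V] (hM : IsGeneric α K M)
    {R : Finset (V × V)} (hR : IsPartialIso α M R) (v : V) :
    ∃ R', R ⊆ R' ∧ IsPartialIso α M R' ∧ v ∈ R'.image Prod.fst := by
  obtain ⟨A, hA, hAcl⟩ := hM.exists_closed_superset (insert v (R.image Prod.fst))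
  set B := R.image Prod.snd with hB
  have hex : ∀ b : B, ∃ a, (a, (b : V)) ∈ R := by
    intro b
    obtain ⟨p, hp, hpb⟩ := Finset.mem_image.1 b.2
    exact ⟨p.1, by rw [← hpb]; exact hp⟩
  choose g hg using hex
  have hgA : ∀ b, g b ∈ A := fun b =>
    hA (Finset.mem_insert_of_mem (Finset.mem_image.2 ⟨_, hg b, rfl⟩))
  let i : B ↪ A := ⟨fun b => ⟨g b, hgA b⟩, fun b c hbc => by
    have h : g b = g c := congrArg Subtype.val hbc
    exact Subtype.ext ((hR.eq_iff _ (hg b) _ (hg c)).1 h)⟩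
  have hi : IsEmb (M.induce B) (M.induce A) i := by
    intro e
    have hT : e.image (fun b => (g b, (b : V))) ⊆ R := by
      intro p hp
      obtain ⟨b, _, rfl⟩ := Finset.mem_image.1 hp
      exact hg b
    have h := hR.edges_iff _ hT
    rw [Finset.image_image, Finset.image_image] at h
    change (e.map i).map _ ∈ M.edges ↔ e.map _ ∈ M.edges
    rw [Finset.map_map, Finset.map_eq_image, Finset.map_eq_image]
    exact h
  have hrange : (Finset.univ.map i).map (Function.Embedding.subtype (· ∈ A)) =
      R.image Prod.fst := by
    ext a
    simp only [Finset.mem_map, Finset.mem_univ, true_and, Finset.mem_image,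
      exists_exists_eq_and, Function.Embedding.subtype_apply]
    constructor
    · rintro ⟨b, rfl⟩
      exact ⟨_, hg b, rfl⟩
    · rintro ⟨p, hp, rfl⟩
      have hb : p.2 ∈ B := Finset.mem_image.2 ⟨p, hp, rfl⟩
      exact ⟨⟨p.2, hb⟩, (hR.eq_iff _ (hg ⟨p.2, hb⟩) _ hp).2 rfl⟩
  have hicl : Closed α (M.induce A) (Finset.univ.map i) := by
    refine Closed.of_map (isEmb_subtype M A) ?_
    rw [hrange]
    exact hR.closed_fst
  obtain ⟨f, hf, hfi, hfcl⟩ := hM.extension B hR.closed_snd A (M.induce A) (hM.age_subset A) i hi hicl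
  have hfst : ∀ T : Finset A, (T.image fun a : A => ((a : V), f a)).image Prod.fst =
      T.map (Function.Embedding.subtype _) := by
    intro T; rw [Finset.image_image, Finset.map_eq_image]; rfl
  have hsnd : ∀ T : Finset A, (T.image fun a : A => ((a : V), f a)).image Prod.snd = T.map f := by
    intro T; rw [Finset.image_image, Finset.map_eq_image]; rfl
  refine ⟨Finset.univ.image fun a : A => ((a : V), f a), ?_, ⟨?_, ?_, ?_, ?_⟩, ?_⟩
  · intro p hp
    have hb : p.2 ∈ B := Finset.mem_image.2 ⟨p, hp, rfl⟩
    refine Finset.mem_image.2 ⟨i ⟨p.2, hb⟩, Finset.mem_univ _, ?_⟩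
    exact Prod.ext ((hR.eq_iff _ (hg ⟨p.2, hb⟩) _ hp).2 rfl) (hfi ⟨p.2, hb⟩)
  · intro p hp q hq
    obtain ⟨a, -, rfl⟩ := Finset.mem_image.1 hp
    obtain ⟨b, -, rfl⟩ := Finset.mem_image.1 hq
    simp only [f.apply_eq_iff_eq, Subtype.ext_iff]
  · intro T hT
    obtain ⟨T, -, rfl⟩ := Finset.subset_image_iff.1 hT
    rw [hfst, hsnd]
    exact (hf T).symm
  · rw [hfst]
    have : (Finset.univ : Finset A).map (Function.Embedding.subtype _) = A := by ext; simp
    rwa [this]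
  · rw [hsnd]; exact hfcl
  · rw [hfst]
    exact Finset.mem_map.2 ⟨⟨v, hA (Finset.mem_insert_self v _)⟩, Finset.mem_univ _, rfl⟩

/-- Every partial isomorphism between finite closed subsets extends to an automorphism. -/
theorem IsGeneric.exists_aut_of_partialIso [DecidableEq V] (hM : IsGeneric α K M)
    {R : Finset (V × V)} (hR : IsPartialIso α M R) :
    ∃ σ ∈ aut M, ∀ p ∈ R, σ p.1 = p.2 := by
  classical
  have := hM.countable
  obtain ⟨_⟩ := nonempty_encodable V
  let P := {R : Finset (V × V) // IsPartialIso α M R}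
  -- Back-and-forth as a generic ideal: one cofinal set for each point to be put in the domain, and
  -- one for each point to be put in the range.
  let D : V ⊕ V → Order.Cofinal P := fun x => Sum.elim
    (fun v => ⟨{R : P | v ∈ R.1.image Prod.fst}, fun R => by
      obtain ⟨R', h1, h2, h3⟩ := hM.extend_partialIso R.2 v
      exact ⟨⟨R', h2⟩, h3, h1⟩⟩)
    (fun v => ⟨{R : P | v ∈ R.1.image Prod.snd}, fun R => by
      obtain ⟨R', h1, h2, h3⟩ := hM.extend_partialIso R.2.swap v
      refine ⟨⟨R'.image Prod.swap, h2.swap⟩, ?_, ?_⟩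
      · simpa [Finset.image_image] using h3
      · intro p hp
        refine Finset.mem_image.2 ⟨p.swap, h1 (Finset.mem_image_of_mem _ hp), by simp⟩⟩) x
  let I := Order.idealOfCofinals (⟨R, hR⟩ : P) D
  have hRI : (⟨R, hR⟩ : P) ∈ I := Order.mem_idealOfCofinals _ _
  have hdir : ∀ a ∈ I, ∀ b ∈ I, ∃ c ∈ I, a.1 ⊆ c.1 ∧ b.1 ⊆ c.1 := fun a ha b hb => by
    obtain ⟨c, hc, h1, h2⟩ := I.directed a ha b hb
    exact ⟨c, hc, h1, h2⟩
  have hfst : ∀ v, ∃ w, ∃ a ∈ I, (v, w) ∈ a.1 := fun v => by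
    obtain ⟨a, ha, haI⟩ := Order.cofinal_meets_idealOfCofinals (⟨R, hR⟩ : P) D (Sum.inl v)
    obtain ⟨p, hp, rfl⟩ := Finset.mem_image.1 (show v ∈ a.1.image Prod.fst from ha)
    exact ⟨p.2, a, haI, hp⟩
  have hsnd : ∀ w, ∃ v, ∃ a ∈ I, (v, w) ∈ a.1 := fun v => by
    obtain ⟨a, ha, haI⟩ := Order.cofinal_meets_idealOfCofinals (⟨R, hR⟩ : P) D (Sum.inr v)
    obtain ⟨p, hp, rfl⟩ := Finset.mem_image.1 (show v ∈ a.1.image Prod.snd from ha)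
    exact ⟨p.1, a, haI, hp⟩
  have hiff : ∀ p q : V × V, (∃ a ∈ I, p ∈ a.1) → (∃ a ∈ I, q ∈ a.1) → (p.1 = q.1 ↔ p.2 = q.2) := by
    rintro p q ⟨a, ha, hpa⟩ ⟨b, hb, hqb⟩
    obtain ⟨c, hc, hac, hbc⟩ := hdir a ha b hb
    exact c.2.eq_iff p (hac hpa) q (hbc hqb)
  choose s hs using hfst
  choose t ht using hsnd
  let σ : Equiv.Perm V := ⟨s, t, fun v => (hiff (t (s v), s v) (v, s v) (ht _) (hs _)).2 rfl,
    fun w => (hiff (t w, s (t w)) (t w, w) (hs _) (ht _)).1 rfl⟩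
  refine ⟨σ, fun e => ?_, fun p hp => (hiff (p.1, s p.1) p (hs _) ⟨_, hRI, hp⟩).1 rfl⟩
  have hfin : ∃ a ∈ I, e.image (fun v => (v, s v)) ⊆ a.1 := by
    induction e using Finset.induction_on with
    | empty => exact ⟨_, hRI, by simp⟩
    | insert v e _ ih =>
      obtain ⟨a, ha, hae⟩ := ih
      obtain ⟨b, hb, hvb⟩ := hs v
      obtain ⟨c, hc, hac, hbc⟩ := hdir a ha b hb
      refine ⟨c, hc, ?_⟩
      rw [Finset.image_insert]
      exact Finset.insert_subset (hbc hvb) (hae.trans hac)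
  obtain ⟨a, _, hae⟩ := hfin
  have h := a.2.edges_iff _ hae
  rw [Finset.image_image, Finset.image_image] at h
  rw [Finset.map_eq_image]
  have hid : e.image (Prod.fst ∘ fun v => (v, s v)) = e := Finset.image_id
  rw [hid] at h
  exact h.symm

/-- Any two flags of closed edges are conjugate under the automorphism group. -/
theorem IsGeneric.exists_aut_of_closed_edges (hM : IsGeneric α K M) {d e : Finset V}
    (hd : d ∈ M.edges) (he : e ∈ M.edges) (hdc : Closed α M d) (hec : Closed α M e)
    {v w : V} (hv : v ∈ d) (hw : w ∈ e) :
    ∃ σ : aut M, d.map σ.1.toEmbedding = e ∧ σ.1 v = w := by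
  classical
  let g₀ : d ≃ e := Finset.equivOfCardEq ((M.uniform d hd).trans (M.uniform e he).symm)
  -- The swap corrects an arbitrary bijection so that it takes `v` to `w`.
  let g : d ≃ e := g₀.trans (Equiv.swap (g₀ ⟨v, hv⟩) ⟨w, hw⟩)
  have hgv : g ⟨v, hv⟩ = ⟨w, hw⟩ := by simp [g]
  let R : Finset (V × V) := Finset.univ.image fun a : d => ((a : V), (g a : V))
  have hRf : R.image Prod.fst = d := by
    ext a; simp [R, Finset.image_image]
  have hRs : R.image Prod.snd = e := by
    ext a
    simp only [R, Finset.image_image, Finset.mem_image, Finset.mem_univ, true_and,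
      Function.comp_apply]
    constructor
    · rintro ⟨x, rfl⟩; exact (g x).2
    · intro ha; exact ⟨g.symm ⟨a, ha⟩, by simp⟩
  have hRd : R.card = r := by
    rw [← M.uniform d hd, Finset.card_image_of_injective _
      (fun a b h => Subtype.ext (congrArg Prod.fst h))]
    simp
  have hR : IsPartialIso α M R := by
    refine ⟨?_, ?_, by rwa [hRf], by rwa [hRs]⟩
    · intro p hp q hq
      obtain ⟨a, -, rfl⟩ := Finset.mem_image.1 hp
      obtain ⟨b, -, rfl⟩ := Finset.mem_image.1 hq
      simp [Subtype.ext_iff.symm]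
    · intro T hT
      -- The projection of `T` can be an edge only if `T` has at least `r` elements, hence is all of
      -- `R`; so the only edges to compare are `d` and `e`.
      have key : r ≤ T.card → T = R := fun h => Finset.eq_of_subset_of_card_le hT (hRd.trans_le h)
      constructor
      · intro h
        rw [key ((M.uniform _ h).symm.trans_le Finset.card_image_le), hRs]
        exact he
      · intro h
        rw [key ((M.uniform _ h).symm.trans_le Finset.card_image_le), hRf]
        exact hd
  obtain ⟨σ, hσ, hσR⟩ := hM.exists_aut_of_partialIso hR
  have hσg : ∀ a : d, σ a = g a := fun a =>
    hσR ((a : V), (g a : V)) (Finset.mem_image_of_mem _ (Finset.mem_univ a))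
  refine ⟨⟨σ, hσ⟩, ?_, ?_⟩
  · refine Finset.eq_of_subset_of_card_le ?_ ?_
    · intro x hx
      obtain ⟨a, ha, rfl⟩ := Finset.mem_map.1 hx
      have := hσg ⟨a, ha⟩
      simp only at this
      change σ a ∈ e
      rw [this]
      exact (g ⟨a, ha⟩).2
    · rw [Finset.card_map, M.uniform d hd, M.uniform e he]
  · have := hσg ⟨v, hv⟩
    rw [hgv] at this
    exact this

end Homogeneity

/-! ### Bases of minimally algebraic pairs -/

section Minimality

variable {r : ℕ} {V : Type*} [DecidableEq V] {α : ℚ} {H : UHypergraph r V}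

/-- The relative predimension depends only on $|B|$ and on the edges of $A\cup B$ not inside $A$.
None of these contains `a`, so erasing `a` loses none of them. -/
theorem predim_sub_erase {A B : Finset V} {a : V} (ha : a ∈ A) (hAB : Disjoint A B)
    (hno : ∀ e ∈ H.edges, a ∈ e → e ⊆ A ∪ B → e ⊆ A) :
    predim α H (A.erase a ∪ B) - predim α H (A.erase a) =
      predim α H (A ∪ B) - predim α H A := by
  classical
  unfold predim
  have haB : a ∉ B := Finset.disjoint_left.1 hAB ha
  have hc1 : (A ∪ B).card = A.card + B.card := Finset.card_union_of_disjoint hAB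
  have hc2 : (A.erase a ∪ B).card = (A.erase a).card + B.card :=
    Finset.card_union_of_disjoint (hAB.mono_left (Finset.erase_subset a A))
  have key : ((A ∪ B).powerset.filter fun e => e ∈ H.edges) \
      (A.powerset.filter fun e => e ∈ H.edges) =
      ((A.erase a ∪ B).powerset.filter fun e => e ∈ H.edges) \
      ((A.erase a).powerset.filter fun e => e ∈ H.edges) := by
    ext e
    simp only [Finset.mem_sdiff, Finset.mem_filter, Finset.mem_powerset]
    have hU : A.erase a ∪ B = (A ∪ B).erase a := by
      rw [Finset.erase_union_distrib, Finset.erase_eq_of_notMem haB]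
    rw [hU]
    simp only [Finset.subset_erase]
    have := hno e
    tauto
  have hs1 : (A.powerset.filter fun e => e ∈ H.edges) ⊆
      ((A ∪ B).powerset.filter fun e => e ∈ H.edges) :=
    Finset.filter_subset_filter _ (Finset.powerset_mono.2 Finset.subset_union_left)
  have hs2 : ((A.erase a).powerset.filter fun e => e ∈ H.edges) ⊆
      ((A.erase a ∪ B).powerset.filter fun e => e ∈ H.edges) :=
    Finset.filter_subset_filter _ (Finset.powerset_mono.2 Finset.subset_union_left)
  have h1 := Finset.card_sdiff_add_card_eq_card hs1
  have h2 := Finset.card_sdiff_add_card_eq_card hs2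
  rw [key] at h1
  rw [hc1, hc2, ← h1, ← h2]
  push_cast
  ring

/-- Every point of the base of a minimally algebraic pair lies on an edge that meets the extension. -/
theorem ZeroMinAlg.exists_edge {A B : Finset V} (h : ZeroMinAlg α H B A) {a : V} (ha : a ∈ A) :
    ∃ e ∈ H.edges, a ∈ e ∧ e ⊆ A ∪ B ∧ ¬ e ⊆ A := by
  by_contra! hno
  obtain ⟨⟨hdis, hne, hz, hpos⟩, hmin⟩ := h
  have key : ∀ B₀ ⊆ B, predim α H (A.erase a ∪ B₀) - predim α H (A.erase a) =
      predim α H (A ∪ B₀) - predim α H A := fun B₀ hB₀ =>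
    predim_sub_erase ha (hdis.mono_right hB₀)
      fun e he hae heB => hno e he hae (heB.trans (Finset.union_subset_union_right hB₀))
  refine hmin _ (Finset.erase_ssubset ha)
    ⟨hdis.mono_left (Finset.erase_subset a A), hne, (key B le_rfl).trans hz, fun B₀ h0 h1 => ?_⟩
  rw [key B₀ h1.1]
  exact hpos B₀ h0 h1

end Minimality

/-! ### Stars and their membership in the collapsed class -/

section Star

/-- The `i`-th petal of the star: the centre `none` and `s` further points. -/
def petal (n s : ℕ) (i : Fin n) : Finset (Option (Fin n × Fin s)) :=
  Finset.insertNone (Finset.univ.map (Function.Embedding.sectR i (Fin s)))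

theorem some_mem_petal {n s : ℕ} {i k : Fin n} {j : Fin s} :
    some (k, j) ∈ petal n s i ↔ k = i := by
  simp [petal, eq_comm]

theorem none_mem_petal {n s : ℕ} (i : Fin n) : none ∈ petal n s i := by
  simp [petal]

theorem petal_injective {n s : ℕ} (hs : 0 < s) : Function.Injective (petal n s) := by
  intro i k h
  have : some (i, (⟨0, hs⟩ : Fin s)) ∈ petal n s k := h ▸ some_mem_petal.2 rfl
  exact some_mem_petal.1 this

/-- The star with `n` edges of size `r` sharing exactly one point. -/
def star (n : ℕ) {r : ℕ} (hr : 2 ≤ r) : UHypergraph r (Option (Fin n × Fin (r - 1))) where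
  edges := Set.range (petal n (r - 1))
  uniform := by
    rintro _ ⟨i, rfl⟩
    rw [petal, Finset.card_insertNone, Finset.card_map, Finset.card_univ, Fintype.card_fin]
    omega

variable {n r : ℕ} {hr : 2 ≤ r} {α : ℚ}

open Classical in
/-- The predimension in the star, in terms of the number of petals contained in the set. -/
theorem predim_star (S : Finset (Option (Fin n × Fin (r - 1)))) :
    predim α (star n hr) S =
      α * S.card - (Finset.univ.filter fun i => petal n (r - 1) i ⊆ S).card := by
  unfold predim
  congr 2
  symm
  refine Finset.card_bij (fun i _ => petal n (r - 1) i) ?_ ?_ ?_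
  · intro i hi
    simp only [Finset.mem_filter, Finset.mem_univ, true_and] at hi
    simp only [Finset.mem_filter, Finset.mem_powerset]
    exact ⟨hi, i, rfl⟩
  · intro i _ j _ h
    exact petal_injective (by omega) h
  · intro e he
    simp only [Finset.mem_filter, Finset.mem_powerset] at he
    obtain ⟨hS, i, rfl⟩ := he
    exact ⟨i, by simpa using hS, rfl⟩

open Classical in
theorem card_filter_petal_subset (S : Finset (Option (Fin n × Fin (r - 1)))) (h : none ∈ S) :
    1 + (Finset.univ.filter fun i => petal n (r - 1) i ⊆ S).card * (r - 1) ≤ S.card := by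
  set I := Finset.univ.filter fun i => petal n (r - 1) i ⊆ S
  have hsub : Finset.insertNone (I ×ˢ (Finset.univ : Finset (Fin (r - 1)))) ⊆ S := by
    intro x hx
    rcases x with _ | ⟨i, j⟩
    · exact h
    · simp only [Finset.some_mem_insertNone, Finset.mem_product, Finset.mem_univ, and_true] at hx
      exact (Finset.mem_filter.1 hx).2 (some_mem_petal.2 rfl)
  have := Finset.card_le_card hsub
  rw [Finset.card_insertNone, Finset.card_product, Finset.card_univ, Fintype.card_fin] at this
  omega

-- Each petal inside `S` accounts for $r-1$ points besides the centre and for one edge.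
open Classical in
theorem predim_star_ge (hα : 1 ≤ α) (S : Finset (Option (Fin n × Fin (r - 1)))) (h : none ∈ S) :
    α + (α * (r - 1) - 1) * (Finset.univ.filter fun i => petal n (r - 1) i ⊆ S).card ≤
      predim α (star n hr) S := by
  rw [predim_star]
  have h1 := card_filter_petal_subset S h
  have h2 : (1 : ℚ) + (Finset.univ.filter fun i => petal n (r - 1) i ⊆ S).card * ((r : ℚ) - 1) ≤
      S.card := by
    have h3 : (((r - 1 : ℕ)) : ℚ) = (r : ℚ) - 1 := by
      rw [Nat.cast_sub (by omega)]; simp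
    rw [← h3]
    exact_mod_cast h1
  nlinarith [mul_le_mul_of_nonneg_left h2 (by linarith : (0 : ℚ) ≤ α)]

theorem predim_star_of_none_notMem (S : Finset (Option (Fin n × Fin (r - 1)))) (h : none ∉ S) :
    predim α (star n hr) S = α * S.card := by
  classical
  rw [predim_star, Finset.filter_false_of_mem]
  · simp
  · exact fun i _ hi => h (hi (none_mem_petal i))

theorem one_le_mul_pred (hr : 2 ≤ r) (hα : 1 ≤ α) : 1 ≤ α * ((r : ℚ) - 1) := by
  have : (2 : ℚ) ≤ r := by exact_mod_cast hr
  nlinarith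

theorem le_predim_star (hα : 1 ≤ α) {S : Finset (Option (Fin n × Fin (r - 1)))}
    (hS : S.Nonempty) : α ≤ predim α (star n hr) S := by
  classical
  by_cases h : none ∈ S
  · have h1 := predim_star_ge (hr := hr) hα S h
    have h2 := one_le_mul_pred hr hα
    have h3 := mul_nonneg (sub_nonneg.2 h2)
      (Nat.cast_nonneg (α := ℚ) (Finset.univ.filter fun i => petal n (r - 1) i ⊆ S).card)
    linarith
  · rw [predim_star_of_none_notMem S h]
    have : (1 : ℚ) ≤ S.card := by exact_mod_cast hS.card_pos
    nlinarith

/-- Without a full petal, $\delta(S)=\alpha|S|>\alpha$; with one, the surplus $\alpha(r-1)-1$ per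
petal is positive. -/
theorem lt_predim_star (hα : 1 ≤ α) (hlt : 1 < α * ((r : ℚ) - 1))
    {S : Finset (Option (Fin n × Fin (r - 1)))} (hS : 1 < S.card) :
    α < predim α (star n hr) S := by
  classical
  have hS' : (1 : ℚ) < S.card := by exact_mod_cast hS
  rcases (Finset.univ.filter fun i => petal n (r - 1) i ⊆ S).card.eq_zero_or_pos with h0 | h0
  · rw [predim_star, h0]
    push_cast
    nlinarith
  · obtain ⟨i, hi⟩ := Finset.card_pos.1 h0
    have h1 := predim_star_ge (hr := hr) hα S ((Finset.mem_filter.1 hi).2 (none_mem_petal i))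
    have h3 := mul_pos (sub_pos.2 hlt) (Nat.cast_pos (α := ℚ).2 h0)
    linarith

theorem inAbInitio_star (hα : 1 ≤ α) : InAbInitio α (star n hr) := by
  intro S
  rcases S.eq_empty_or_nonempty with rfl | hS
  · rw [predim_star_of_none_notMem _ (by simp)]; simp
  · linarith [le_predim_star (hr := hr) hα hS]

/-- A set `C` containing the petal has $\delta(C)\ge\alpha+(\alpha(r-1)-1)=\alpha r-1$, which bounds
the predimension of the petal from above. -/
theorem closed_petal (hα : 1 ≤ α) (i : Fin n) : Closed α (star n hr) (petal n (r - 1) i) := by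
  classical
  refine fun B hB => ⟨hB, fun C hC _ => ?_⟩
  have h1 := predim_star_ge (hr := hr) hα C (hC (none_mem_petal i))
  have h2 := one_le_mul_pred hr hα
  have h3 : 1 ≤ (Finset.univ.filter fun k => petal n (r - 1) k ⊆ C).card :=
    Finset.card_pos.2 ⟨i, by simpa using hC⟩
  have h4 : 1 ≤ (Finset.univ.filter fun k => petal n (r - 1) k ⊆ petal n (r - 1) i).card :=
    Finset.card_pos.2 ⟨i, by simp⟩
  have h5 : (petal n (r - 1) i).card = r := (star n hr).uniform _ ⟨i, rfl⟩
  have h6 := predim_star (hr := hr) (α := α) (petal n (r - 1) i)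
  rw [h5] at h6
  have h3' : (1 : ℚ) ≤ (Finset.univ.filter fun k => petal n (r - 1) k ⊆ C).card := by
    exact_mod_cast h3
  have h4' : (1 : ℚ) ≤
      (Finset.univ.filter fun k => petal n (r - 1) k ⊆ petal n (r - 1) i).card := by
    exact_mod_cast h4
  nlinarith [mul_nonneg (sub_nonneg.2 h2) (sub_nonneg.2 h3')]

/-- The star belongs to the collapsed class. -/
theorem inCollapsed_star (hα : 1 ≤ α) {E : Set (Pair r)} (hE : E ⊆ minAlgPairs r α)
    {μ : Pair r → ℕ} (hμ : ∀ P ∈ E, predim α P.H P.A ≤ (μ P : ℚ))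
    (hdeg : r = 2 → α = 1 → ∀ P ∈ E, P.A.Nonempty → n ≤ μ P) :
    InCollapsed α E μ (star n hr) := by
  classical
  refine ⟨inAbInitio_star hα, fun P hP F hF hA hB => ?_⟩
  obtain ⟨-, hmin⟩ := hE hP
  obtain ⟨hdis, hne, hz, -⟩ := id hmin.1
  rcases F.eq_empty_or_nonempty with rfl | ⟨f, hf⟩
  · simp
  have hAB : predim α P.H P.A = predim α P.H (P.A ∪ P.B) := by linarith
  have hge : α ≤ predim α P.H P.A := by
    rw [hAB, ← predim_map α (hF f hf)]
    exact le_predim_star hα ((hne.mono Finset.subset_union_right).map)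
  have hμ1 : 1 ≤ μ P := by
    have := hμ P hP
    exact_mod_cast (hα.trans (hge.trans this))
  rcases le_or_gt F.card 1 with h1 | h1
  · exact h1.trans hμ1
  have hAne : P.A.Nonempty := by
    rw [Finset.nonempty_iff_ne_empty]
    intro h0
    rw [h0] at hge
    simp [predim] at hge
    have hc : 0 ≤ ((({∅} : Finset (Finset (Fin P.n))).filter fun e => e ∈ P.H.edges).card : ℚ) :=
      Nat.cast_nonneg _
    linarith
  obtain ⟨g, hg, hgf⟩ := Finset.exists_mem_ne h1 f
  -- A point other than the centre lies on a single petal. By minimality `a` lies on an edge meeting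
  -- `B`, so both copies would send that edge to the same petal and their images of `B` would
  -- intersect.
  have hcentre : ∀ a ∈ P.A, f a = none := by
    intro a ha
    by_contra hfa
    obtain ⟨⟨i, j⟩, hij⟩ := Option.ne_none_iff_exists'.1 hfa
    obtain ⟨e, he, hae, -, heA⟩ := hmin.exists_edge ha
    have himg : ∀ h ∈ F, h a = some (i, j) → e.map h = petal n (r - 1) i := by
      intro h hh hha
      obtain ⟨k, hk⟩ := (hF h hh e).2 he
      have : some (i, j) ∈ petal n (r - 1) k := by
        rw [hk, ← hha]; exact Finset.mem_map_of_mem h hae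
      rw [← hk, some_mem_petal.1 this]
    have hfg : e.map f = e.map g := by
      rw [himg f hf hij, himg g hg ((hA g hg f hf a ha).trans hij)]
    obtain ⟨b, hbe, hbA⟩ := Finset.not_subset.1 heA
    have hbB : b ∈ P.B := Finset.mem_compl.2 hbA
    have : f b ∈ e.map g := hfg ▸ Finset.mem_map_of_mem f hbe
    obtain ⟨c, -, hc⟩ := Finset.mem_map.1 this
    by_cases hcA : c ∈ P.A
    · rw [hA g hg f hf c hcA] at hc
      exact hbA (f.injective hc ▸ hcA)
    · refine Finset.disjoint_left.1 (hB g hg f hf hgf)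
        (Finset.mem_map_of_mem g (Finset.mem_compl.2 hcA)) ?_
      rw [hc]
      exact Finset.mem_map_of_mem f hbB
  obtain ⟨a, ha⟩ := hAne
  have hAa : P.A = {a} := by
    refine Finset.eq_singleton_iff_unique_mem.2 ⟨ha, fun b hb => ?_⟩
    exact f.injective ((hcentre b hb).trans (hcentre a ha).symm)
  -- If $\alpha(r-1)>1$, then $\delta(A\cup B)>\alpha\ge\delta(A)$, against $0$-algebraicity.
  -- Equality forces $r=2$, $\alpha=1$.
  rcases (one_le_mul_pred hr hα).lt_or_eq with hlt | heq
  · have hcard : 1 < ((P.A ∪ P.B).map f).card := by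
      rw [Finset.card_map, Finset.card_union_of_disjoint hdis, hAa]
      have := hne.card_pos
      simp only [Finset.card_singleton]
      omega
    have h2 := lt_predim_star (hr := hr) hα hlt hcard
    rw [predim_map α (hF f hf), ← hAB, hAa] at h2
    have h3 : predim α P.H {a} ≤ α := by
      simp only [predim, Finset.card_singleton, Nat.cast_one, mul_one]
      exact sub_le_self _ (Nat.cast_nonneg _)
    linarith
  · have hr2 : (2 : ℚ) ≤ r := by exact_mod_cast hr
    have hr' : (r : ℚ) = 2 := by nlinarith
    have hα1 : α = 1 := by rw [hr'] at heq; linarith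
    have hreq : r = 2 := by exact_mod_cast hr'
    refine le_trans ?_ (hdeg hreq hα1 P hP ⟨a, ha⟩)
    -- Disjoint copies send `b` to distinct points other than the centre, and for $r=2$ there are
    -- only `n` of these.
    obtain ⟨b, hb⟩ := hne
    have hinj : Set.InjOn (fun h : Fin P.n ↪ Option (Fin n × Fin (r - 1)) => h b) F := by
      intro h hh k hk hhk
      by_contra hne
      refine Finset.disjoint_left.1 (hB h hh k hk hne) (Finset.mem_map_of_mem h hb) ?_
      simp only at hhk
      rw [hhk]
      exact Finset.mem_map_of_mem k hb
    have hmaps : ∀ h ∈ F, h b ∈ (Finset.univ.erase none : Finset (Option (Fin n × Fin (r - 1)))) := by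
      intro h hh
      refine Finset.mem_erase.2 ⟨fun h0 => ?_, Finset.mem_univ _⟩
      have := (hA h hh f hf a ha).trans (hcentre a ha)
      have := h.injective (h0.trans this.symm)
      exact Finset.disjoint_left.1 hdis ha (this ▸ hb)
    have := Finset.card_le_card_of_injOn _ hmaps hinj
    rw [Finset.card_erase_of_mem (Finset.mem_univ _), Finset.card_univ] at this
    simpa [hreq] using this

end Star

open MeasureTheory Topology

/-! ### Fractional orientations and their average -/

section Orientation

variable {r : ℕ} {V : Type} {α : ℚ} {M : UHypergraph r V}

/-- A fractional orientation: every edge distributes weight `1` among its points in such a way that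
no point receives more than `α`. -/
structure IsOrientation (α : ℚ) (M : UHypergraph r V) (φ : Finset V × V → ℝ) : Prop where
  nonneg : ∀ x, 0 ≤ φ x
  le_one : ∀ x, φ x ≤ 1
  sum_edge : ∀ e ∈ M.edges, ∑ v ∈ e, φ (e, v) = 1
  sum_point : ∀ (v : V) (T : Finset (Finset V)), (∀ e ∈ T, e ∈ M.edges) →
    ∑ e ∈ T, φ (e, v) ≤ α

open Classical in
theorem card_le_of_inAbInitio (hM : InAbInitio α M) (T : Finset (Finset V))
    (hT : ∀ e ∈ T, e ∈ M.edges) : (T.card : ℚ) ≤ α * (T.biUnion id).card := by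
  have h := hM (T.biUnion id)
  unfold predim at h
  have h2 : T ⊆ (T.biUnion id).powerset.filter fun e => e ∈ M.edges := by
    intro e he
    simp only [Finset.mem_filter, Finset.mem_powerset]
    exact ⟨Finset.subset_biUnion_of_mem id he, hT e he⟩
  have h3 : (T.card : ℚ) ≤ ((T.biUnion id).powerset.filter fun e => e ∈ M.edges).card := by
    exact_mod_cast Finset.card_le_card h2
  linarith

/-- With $\alpha=p/q$, split each edge into $q$ tokens and give each point $p$ slots. Hall's theorem
places the tokens injectively into slots at points of their edges; each token carries weight $1/q$.
-/
theorem exists_isOrientation (hα : 0 ≤ α) (hM : InAbInitio α M) :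
    ∃ φ, IsOrientation α M φ := by
  classical
  set q := α.den with hq
  set p := α.num.toNat with hp
  have hq0 : 0 < q := α.den_pos
  have hpq : (p : ℚ) = α * q := by
    rw [hq, Rat.mul_den_eq_num, hp]
    exact_mod_cast Int.toNat_of_nonneg (Rat.num_nonneg.2 hα)
  let t : M.edges × Fin q → Finset (V × Fin p) := fun x => x.1.1 ×ˢ Finset.univ
  -- Hall's condition: if `T` is the set of edges with a token in `s`, then $|s|\le q|T|\le
  -- p\,|\bigcup T|$, the last step being $\delta(\bigcup T)\ge 0$.
  have hall : ∀ s : Finset (M.edges × Fin q), s.card ≤ (s.biUnion t).card := by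
    intro s
    let T : Finset (Finset V) := s.image fun x => x.1.1
    have h1 : s.biUnion t = T.biUnion id ×ˢ Finset.univ := by
      ext ⟨v, j⟩
      simp only [Finset.mem_biUnion, Finset.mem_product, Finset.mem_univ, and_true, t, T,
        Finset.mem_image, id]
      constructor
      · rintro ⟨x, hx, hv⟩; exact ⟨_, ⟨x, hx, rfl⟩, hv⟩
      · rintro ⟨_, ⟨x, hx, rfl⟩, hv⟩; exact ⟨x, hx, hv⟩
    have h2 : s.card ≤ T.card * q := by
      have : s.card ≤ (T ×ˢ (Finset.univ : Finset (Fin q))).card := by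
        refine Finset.card_le_card_of_injOn (fun x => (x.1.1, x.2)) ?_ ?_
        · intro x hx
          simp only [Finset.coe_product, Set.mem_prod, Finset.mem_coe, Finset.mem_univ, and_true]
          exact Finset.mem_image_of_mem _ hx
        · rintro ⟨⟨a, ha⟩, i⟩ _ ⟨⟨b, hb⟩, j⟩ _ h
          simpa using h
      simpa using this
    have h3 := card_le_of_inAbInitio hM T (by
      intro e he
      obtain ⟨x, -, rfl⟩ := Finset.mem_image.1 he
      exact x.1.2)
    rw [h1, Finset.card_product, Finset.card_univ, Fintype.card_fin]
    refine h2.trans ?_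
    have h4 : (T.card : ℚ) * q ≤ (T.biUnion id).card * p := by
      rw [hpq]
      nlinarith [mul_le_mul_of_nonneg_right h3 (Nat.cast_nonneg (α := ℚ) q)]
    exact_mod_cast h4
  obtain ⟨f, hfinj, hft⟩ := (Finset.all_card_le_biUnion_card_iff_exists_injective t).1 hall
  have hfe : ∀ x, (f x).1 ∈ x.1.1 := fun x => by
    have := hft x
    simp only [t, Finset.mem_product] at this
    exact this.1
  let N : Finset V × V → ℕ := fun x => if h : x.1 ∈ M.edges then
    (Finset.univ.filter fun i : Fin q => (f (⟨x.1, h⟩, i)).1 = x.2).card else 0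
  have hN : ∀ (e : Finset V) (h : e ∈ M.edges) (v : V), N (e, v) =
      (Finset.univ.filter fun i : Fin q => (f (⟨e, h⟩, i)).1 = v).card := fun e h v => by
    simp only [N, h, dif_pos]
  have hqR : (0 : ℝ) < q := by exact_mod_cast hq0
  refine ⟨fun x => N x / q, ⟨fun x => by positivity, fun x => ?_, ?_, ?_⟩⟩
  · rw [div_le_one hqR]
    have : N x ≤ q := by
      by_cases h : x.1 ∈ M.edges
      · rw [show x = (x.1, x.2) from rfl, hN x.1 h]
        exact (Finset.card_filter_le _ _).trans (by simp)
      · simp [N, h]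
    exact_mod_cast this
  · intro e he
    rw [← Finset.sum_div, div_eq_one_iff_eq hqR.ne']
    have : ∑ v ∈ e, N (e, v) = q := by
      simp only [hN e he]
      rw [← Finset.card_eq_sum_card_fiberwise (fun i _ => hfe (⟨e, he⟩, i))]
      simp
    exact_mod_cast this
  · intro v T hT
    rw [← Finset.sum_div, div_le_iff₀ hqR]
    have h1 : ∑ e ∈ T, N (e, v) ≤ p := by
      let S : Finset (M.edges × Fin q) :=
        ((T.subtype (· ∈ M.edges)) ×ˢ Finset.univ).filter fun x => (f x).1 = v
      have hS : ∑ e ∈ T, N (e, v) = S.card := by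
        rw [← Finset.sum_subtype_of_mem (p := (· ∈ M.edges)) (fun e => N (e, v)) hT]
        simp only [S, Finset.card_filter, Finset.sum_product]
        refine Finset.sum_congr rfl fun e _ => ?_
        rw [hN e.1 e.2, Finset.card_filter]
      rw [hS]
      have : S.card ≤ (Finset.univ : Finset (Fin p)).card := by
        refine Finset.card_le_card_of_injOn (fun x => (f x).2) (fun _ _ => by simp) ?_
        intro x hx y hy hxy
        refine hfinj (Prod.ext ?_ hxy)
        rw [(Finset.mem_filter.1 hx).2, (Finset.mem_filter.1 hy).2]
      simpa using this
    have h2 : ((∑ e ∈ T, N (e, v) : ℕ) : ℚ) ≤ α * q := by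
      rw [← hpq]; exact_mod_cast h1
    exact_mod_cast h2

/-- The compact space of fractional orientations. -/
abbrev Orientation (α : ℚ) (M : UHypergraph r V) : Type := {φ // IsOrientation α M φ}

theorem isClosed_isOrientation : IsClosed {φ | IsOrientation α M φ} := by
  have : {φ | IsOrientation α M φ} = {φ | ∀ x, 0 ≤ φ x} ∩ ({φ | ∀ x, φ x ≤ 1} ∩
      ({φ | ∀ e ∈ M.edges, ∑ v ∈ e, φ (e, v) = 1} ∩ {φ | ∀ (v : V) (T : Finset (Finset V)),
        (∀ e ∈ T, e ∈ M.edges) → ∑ e ∈ T, φ (e, v) ≤ (α : ℝ)})) := by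
    ext φ
    exact ⟨fun h => ⟨h.1, h.2, h.3, h.4⟩, fun h => ⟨h.1, h.2.1, h.2.2.1, h.2.2.2⟩⟩
  rw [this]
  simp only [Set.ofPred_forall]
  refine IsClosed.inter ?_ (IsClosed.inter ?_ (IsClosed.inter ?_ ?_))
  · exact isClosed_iInter fun x => isClosed_le (by fun_prop) (by fun_prop)
  · exact isClosed_iInter fun x => isClosed_le (by fun_prop) (by fun_prop)
  · exact isClosed_iInter fun e => isClosed_iInter fun _ =>
      isClosed_eq (by fun_prop) (by fun_prop)
  · exact isClosed_iInter fun v => isClosed_iInter fun T => isClosed_iInter fun _ =>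
      isClosed_le (by fun_prop) (by fun_prop)

instance : CompactSpace (Orientation α M) := by
  refine isCompact_iff_compactSpace.1 (?_ : IsCompact {φ | IsOrientation α M φ})
  refine IsCompact.of_isClosed_subset
    (isCompact_univ_pi fun _ : Finset V × V => isCompact_Icc (a := (0 : ℝ)) (b := 1))
    isClosed_isOrientation ?_
  exact fun φ hφ x _ => ⟨hφ.nonneg x, hφ.le_one x⟩

theorem IsOrientation.comp_aut {φ : Finset V × V → ℝ} (hφ : IsOrientation α M φ) (g : aut M) :
    IsOrientation α M fun x => φ (x.1.map g.1.toEmbedding, g.1 x.2) := by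
  refine ⟨fun x => hφ.nonneg _, fun x => hφ.le_one _, fun e he => ?_, fun v T hT => ?_⟩
  · have := hφ.sum_edge _ ((g.2 e).2 he)
    rwa [Finset.sum_map] at this
  · have := hφ.sum_point (g.1 v) (T.map (Finset.mapEmbedding g.1.toEmbedding).toEmbedding) (by
      intro e he
      obtain ⟨d, hd, rfl⟩ := Finset.mem_map.1 he
      exact (g.2 d).2 (hT d hd))
    rwa [Finset.sum_map] at this

instance : MulAction (aut M) (Orientation α M) where
  smul g φ := ⟨_, φ.2.comp_aut g⁻¹⟩
  one_smul φ := Subtype.ext <| funext fun x => by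
    change φ.1 (x.1.map (1 : aut M)⁻¹.1.toEmbedding, (1 : aut M)⁻¹.1 x.2) = φ.1 x
    rw [inv_one]
    exact congrArg φ.1 (Prod.ext Finset.map_refl rfl)
  mul_smul g h φ := Subtype.ext <| funext fun x => by
    change φ.1 (x.1.map (g * h)⁻¹.1.toEmbedding, (g * h)⁻¹.1 x.2) =
      φ.1 ((x.1.map g⁻¹.1.toEmbedding).map h⁻¹.1.toEmbedding, h⁻¹.1 (g⁻¹.1 x.2))
    rw [mul_inv_rev, Finset.map_map]
    rfl

theorem smul_orientation_apply (g : aut M) (φ : Orientation α M) (x : Finset V × V) :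
    (g • φ).1 x = φ.1 (x.1.map g⁻¹.1.toEmbedding, g⁻¹.1 x.2) := rfl

theorem isOpen_aut_apply_eq (v w : V) : IsOpen {g : aut M | g.1 v = w} := by
  have h1 : IsOpen {g : Equiv.Perm V | g v = w} := by
    let : TopologicalSpace V := ⊥
    have : DiscreteTopology V := ⟨rfl⟩
    have hc : Continuous fun g : Equiv.Perm V => (g : V → V) := continuous_induced_dom
    exact (isOpen_discrete {w}).preimage ((continuous_apply v).comp hc)
  exact h1.preimage continuous_subtype_val

theorem eventually_inv_apply_eq (g : aut M) (w : V) : ∀ᶠ h in 𝓝 g, h⁻¹.1 w = g⁻¹.1 w := by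
  filter_upwards [(isOpen_aut_apply_eq (g⁻¹.1 w) w).mem_nhds (x := g) (by simp)] with h hh
  change h.1⁻¹ w = _
  rw [Equiv.Perm.inv_eq_iff_eq]
  exact hh.symm

instance : ContinuousSMul (aut M) (Orientation α M) := by
  refine ⟨Continuous.subtype_mk (p := IsOrientation α M) (continuous_pi fun x => ?_) _⟩
  rw [continuous_iff_continuousAt]
  rintro ⟨g, φ⟩
  -- The value at `x` involves $g^{-1}$ only on finitely many points, so near `g` the group element
  -- may be frozen.
  have hev : ∀ᶠ y : aut M × Orientation α M in 𝓝 (g, φ),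
      y.2.1 (x.1.map g⁻¹.1.toEmbedding, g⁻¹.1 x.2) =
        y.2.1 (x.1.map y.1⁻¹.1.toEmbedding, y.1⁻¹.1 x.2) := by
    have h1 : ∀ᶠ h in 𝓝 g, ∀ v ∈ x.1, h⁻¹.1 v = g⁻¹.1 v :=
      (Filter.eventually_all_finset x.1).2 fun v _ => eventually_inv_apply_eq g v
    have h2 := h1.and (eventually_inv_apply_eq g x.2)
    rw [nhds_prod_eq]
    filter_upwards [h2.prod_inl (𝓝 φ)] with y hy
    rw [hy.2]
    refine congrArg (fun d => y.2.1 (d, _)) ?_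
    classical
    rw [Finset.map_eq_image, Finset.map_eq_image]
    exact Finset.image_congr fun v hv => (hy.1 v hv).symm
  refine ContinuousAt.congr (Continuous.continuousAt ?_) hev
  exact (continuous_apply _).comp (continuous_subtype_val.comp continuous_snd)

/-- If the automorphism group is amenable, there is an invariant fractional orientation. -/
theorem IsAmenable.exists_invariant_orientation (hα : 0 ≤ α) (hM : InAbInitio α M)
    (hG : IsAmenable (aut M)) :
    ∃ c, IsOrientation α M c ∧
      ∀ (g : aut M) (e : Finset V) (v : V), c (e.map g.1.toEmbedding, g.1 v) = c (e, v) := by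
  let : MeasurableSpace (Orientation α M) := borel _
  have : BorelSpace (Orientation α M) := ⟨rfl⟩
  have : Nonempty (Orientation α M) := by
    obtain ⟨φ, hφ⟩ := exists_isOrientation hα hM
    exact ⟨⟨φ, hφ⟩⟩
  obtain ⟨m, hm, hinv⟩ := hG (Orientation α M)
  have hcont : ∀ x, Continuous fun φ : Orientation α M => φ.1 x := fun x =>
    (continuous_apply x).comp continuous_subtype_val
  have hint : ∀ x, Integrable (fun φ : Orientation α M => φ.1 x) m := fun x =>
    Integrable.of_bound (hcont x).measurable.aestronglyMeasurable 1
      (Filter.Eventually.of_forall fun φ => by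
        rw [Real.norm_of_nonneg (φ.2.nonneg x)]; exact φ.2.le_one x)
  -- The barycentre of the invariant measure; the defining equalities and inequalities are linear
  -- and pass to the mean.
  refine ⟨fun x => ∫ φ, φ.1 x ∂m, ⟨fun x => ?_, fun x => ?_, fun e he => ?_, fun v T hT => ?_⟩,
    fun g e v => ?_⟩
  · exact integral_nonneg fun φ => φ.2.nonneg x
  · refine (integral_mono (hint x) (integrable_const 1) fun φ => φ.2.le_one x).trans ?_
    simp
  · rw [← integral_finsetSum _ fun v _ => hint (e, v)]
    simp [fun φ : Orientation α M => φ.2.sum_edge e he]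
  · rw [← integral_finsetSum _ fun e _ => hint (e, v)]
    refine (integral_mono (integrable_finsetSum _ fun e _ => hint (e, v))
      (integrable_const (α : ℝ)) fun φ => φ.2.sum_point v T hT).trans ?_
    simp
  · have h := integral_map (μ := m) (φ := fun φ : Orientation α M => g⁻¹ • φ)
      (continuous_const_smul g⁻¹).measurable.aemeasurable
      (f := fun φ : Orientation α M => φ.1 (e, v))
      (hcont (e, v)).measurable.aestronglyMeasurable
    rw [hinv g⁻¹] at h
    simp only [smul_orientation_apply, inv_inv] at h
    exact h.symm

end Orientation

/-! ### Closed stars in the generic structure and the contradiction -/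

theorem IsGeneric.inAbInitio {r : ℕ} {α : ℚ} {V : Type} {K : ∀ W : Type, UHypergraph r W → Prop}
    {M : UHypergraph r V} (hM : IsGeneric α K M)
    (hK : ∀ (W : Type) (H : UHypergraph r W), K W H → InAbInitio α H) : InAbInitio α M := by
  intro S
  have h := hK _ _ (hM.age_subset S) Finset.univ
  rw [← predim_map α (isEmb_subtype M S)] at h
  have : (Finset.univ : Finset S).map (Function.Embedding.subtype _) = S := by ext; simp
  rwa [this] at h

/-- The extension property over the empty base, which is closed because $\delta\ge
0=\delta(\emptyset)$. -/
theorem IsGeneric.exists_closed_emb {r : ℕ} {α : ℚ} {V : Type}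
    {K : ∀ W : Type, UHypergraph r W → Prop} {M : UHypergraph r V} (hM : IsGeneric α K M)
    (hK : ∀ (W : Type) (H : UHypergraph r W), K W H → InAbInitio α H)
    (W : Type) [Fintype W] (H : UHypergraph r W) (hH : K W H) :
    ∃ f : W ↪ V, IsEmb H M f ∧ Closed α M (Finset.univ.map f) := by
  have hempty : ∀ (U : Type) (L : UHypergraph r U), InAbInitio α L → predim α L ∅ = 0 →
      Closed α L ∅ := fun U L hL h0 B _ => ⟨Finset.empty_subset B, fun C _ _ => by
    rw [h0, sub_zero]; exact hL C⟩
  have h0 : ∀ (U : Type) (L : UHypergraph r U), InAbInitio α L → predim α L ∅ = 0 := by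
    classical
    intro U L hL
    refine le_antisymm ?_ (hL ∅)
    simp only [predim, Finset.card_empty, Nat.cast_zero, mul_zero, zero_sub]
    exact neg_nonpos.2 (Nat.cast_nonneg _)
  have hMi := hM.inAbInitio hK
  have hHi := hK W H hH
  let i : (∅ : Finset V) ↪ W := ⟨fun x => (Finset.notMem_empty _ x.2).elim,
    fun x => (Finset.notMem_empty _ x.2).elim⟩
  have huniv : (Finset.univ : Finset (∅ : Finset V)).map i = ∅ := by
    rw [Finset.map_eq_empty, Finset.univ_eq_empty_iff]
    exact ⟨fun x => Finset.notMem_empty _ x.2⟩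
  have hi : IsEmb (M.induce ∅) H i := by
    intro e
    have he : e = ∅ := Finset.eq_empty_of_forall_notMem fun x => (Finset.notMem_empty _ x.2).elim
    subst he
    -- Here `r` may be $0$; an empty edge is excluded by $\delta(\emptyset)\ge 0$.
    have hne : ∀ (U : Type) (L : UHypergraph r U), InAbInitio α L → (∅ : Finset U) ∉ L.edges := by
      classical
      intro U L hL he
      have h := hL ∅
      simp only [predim, Finset.card_empty, Nat.cast_zero, mul_zero, zero_sub] at h
      have : 0 < ((∅ : Finset U).powerset.filter fun e => e ∈ L.edges).card :=
        Finset.card_pos.2 ⟨∅, by simp [he]⟩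
      have : (0 : ℚ) < ((∅ : Finset U).powerset.filter fun e => e ∈ L.edges).card := by
        exact_mod_cast this
      linarith
    change (∅ : Finset _).map i ∈ H.edges ↔ (∅ : Finset _).map _ ∈ M.edges
    rw [Finset.map_empty, Finset.map_empty]
    exact iff_of_false (hne _ H hHi) (hne _ M hMi)
  obtain ⟨f, hf, -, hfc⟩ := hM.extension ∅ (hempty V M hMi (h0 V M hMi)) W H hH i hi (by
    rw [huniv]; exact hempty W H hHi (h0 W H hHi))
  exact ⟨f, hf, hfc⟩

theorem natCast_le_of_closed_star {r n : ℕ} (hr : 2 ≤ r) {α : ℚ} (hα : 1 ≤ α) {V : Type}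
    {K : ∀ W : Type, UHypergraph r W → Prop} {M : UHypergraph r V} (hM : IsGeneric α K M)
    (hMi : InAbInitio α M) (hG : IsAmenable (aut M))
    {f : Option (Fin n × Fin (r - 1)) ↪ V} (hf : IsEmb (star n hr) M f)
    (hfc : Closed α M (Finset.univ.map f)) : (n : ℚ) ≤ α * r := by
  classical
  obtain ⟨c, hc, hinv⟩ := hG.exists_invariant_orientation (by linarith) hMi
  rcases n.eq_zero_or_pos with rfl | hn
  · simp only [Nat.cast_zero]; positivity
  let d : Fin n → Finset V := fun i => (petal n (r - 1) i).map f
  have hd : ∀ i, d i ∈ M.edges := fun i => (hf _).2 ⟨i, rfl⟩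
  have hdc : ∀ i, Closed α M (d i) := fun i =>
    ((closed_petal (hr := hr) hα i).map hf (Finset.subset_univ _)).trans_closed hfc
  have hdn : ∀ i, f none ∈ d i := fun i => Finset.mem_map_of_mem f (none_mem_petal i)
  -- All flags of petals are conjugate, so they carry one common weight, which must be $1/r$.
  have hconj : ∀ i k, ∀ v ∈ d i, ∀ w ∈ d k, c (d i, v) = c (d k, w) := by
    intro i k v hv w hw
    obtain ⟨σ, h1, h2⟩ := hM.exists_aut_of_closed_edges (hd i) (hd k) (hdc i) (hdc k) hv hw
    rw [← hinv σ, h1, h2]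
  let i₀ : Fin n := ⟨0, hn⟩
  have hsum : (r : ℝ) * c (d i₀, f none) = 1 := by
    rw [← hc.sum_edge _ (hd i₀), Finset.sum_congr rfl
      fun v hv => hconj i₀ i₀ v hv (f none) (hdn i₀), Finset.sum_const, M.uniform _ (hd i₀),
      nsmul_eq_mul]
  have hinj : Function.Injective d :=
    (Finset.map_injective f).comp (petal_injective (by omega))
  have hpt := hc.sum_point (f none) (Finset.univ.image d) (by
    intro e he
    obtain ⟨i, -, rfl⟩ := Finset.mem_image.1 he
    exact hd i)
  rw [Finset.sum_image (fun i _ k _ h => hinj h), Finset.sum_congr rfl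
    fun i _ => hconj i i₀ _ (hdn i) _ (hdn i₀), Finset.sum_const, Finset.card_univ,
    Fintype.card_fin, nsmul_eq_mul] at hpt
  have h := mul_le_mul_of_nonneg_right hpt (Nat.cast_nonneg (α := ℝ) r)
  have h2 : (n : ℝ) ≤ α * r := by
    calc (n : ℝ) = n * c (d i₀, f none) * r := by linear_combination -(n : ℝ) * hsum
      _ ≤ α * r := h
  exact_mod_cast h2

end Collapsed

theorem mainTheorem2 (r : ℕ) (hr : 2 ≤ r) (α : ℚ) (hα : 1 ≤ α)
    (E : Set (Collapsed.Pair r))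
    (hE : E = Collapsed.minAlgPairsNonempty r α ∨ E = Collapsed.minAlgPairs r α)
    (μ : Collapsed.Pair r → ℕ) (hμ : Collapsed.IsMu α E μ)
    (hdeg : r = 2 → α = 1 → ∀ P ∈ E, P.A.Nonempty → 3 ≤ μ P)
    {V : Type} (M : Collapsed.UHypergraph r V)
    (hM : Collapsed.IsGeneric α (fun _ H => Collapsed.InCollapsed α E μ H) M) :
    ¬ Collapsed.IsAmenable (Collapsed.aut M) := by
  intro hG
  have hE' : E ⊆ Collapsed.minAlgPairs r α := by
    rcases hE with rfl | rfl
    · exact fun P hP => hP.1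
    · exact le_rfl
  have hK : ∀ (W : Type) (H : Collapsed.UHypergraph r W), Collapsed.InCollapsed α E μ H →
      Collapsed.InAbInitio α H := fun _ _ h => h.1
  -- For $r=2$, $\alpha=1$ the star with `n` edges is known to be in the class only when $n\le 3$,
  -- the given lower bound on `μ`.
  have hbound : ∀ n : ℕ, (r = 2 → α = 1 → n ≤ 3) → (n : ℚ) ≤ α * r := by
    intro n hn
    have hstar := Collapsed.inCollapsed_star (n := n) (hr := hr) hα hE' hμ.lower_bound
      fun h2 h1 P hP hA => (hn h2 h1).trans (hdeg h2 h1 P hP hA)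
    obtain ⟨f, hf, hfc⟩ := hM.exists_closed_emb hK _ _ hstar
    exact Collapsed.natCast_le_of_closed_star hr hα hM (hM.inAbInitio hK) hG hf hfc
  by_cases hs : r = 2 ∧ α = 1
  · have := hbound 3 fun _ _ => le_rfl
    rw [hs.1, hs.2] at this
    norm_num at this
  · obtain ⟨n, hn⟩ := exists_nat_gt (α * r)
    exact hn.not_ge (hbound n fun h2 h1 => (hs ⟨h2, h1⟩).elim)
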